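/- Let $d\ge 2$ and $N\ge 2$ be integers. Let $|i_1,\dots,i_N\rangle$, $0\le i_1,\dots,i_N\le d-1$, be the standard orthonormal basis of $(\mathbb{C}^d)^{\otimes N}$, and for $k=0,1,\dots,N(d-1)$ let $$|R_{N,d;k}\rangle=\sum_{i_1+\dots+i_N=k}|i_1,\dots,i_N\rangle .$$ Let $p_0,\dots,p_{N(d-1)}\ge 0$ be real numbers and let $$\rho=\sum_{k=0}^{N(d-1)}p_k\,|R_{N,d;k}\rangle\langle R_{N,d;k}| .$$ The (unnormalized) state $\rho$ is called fully separable if it is a finite sum $\rho=\sum_a c_a\,\rho_a^1\otimes\dots\otimes\rho_a^N$ with numbers $c_a>0$ and positive semidefinite operators $\rho_a^j$ on $\mathbb{C}^d$. A real sequence $(p_k)_{k=0}^n$ is called a solution of the generalized moment problem on $[0,\infty)$ if there are a positive Borel measure $\sigma$ with support contained in $[0,\infty)$ and finite moments up to order $n$, and a number $M\ge 0$, such that $p_k=\int_0^\infty t^k\,d\sigma(t)$ for $k=0,\dots,n-1$ and $p_n=\int_0^\infty t^n\,d\sigma(t)+M$. Then $\rho$ is fully separable if and only if $(p_k)_{k=0}^{N(d-1)}$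 is a solution of the generalized moment problem on $[0,\infty)$. -/

import Mathlib

open scoped ComplexOrder

noncomputable section

/-- A multi-index `i = (i_1, …, i_N)` with `0 ≤ i_j ≤ d - 1`.  The multi-indices label the standard
orthonormal basis `|i⟩ = |i_1, …, i_N⟩` of `(ℂ^d)^{⊗N}`. -/
abbrev MultiIndex (N d : ℕ) : Type := Fin N → Fin d

/-- The weight `|i| = i_1 + … + i_N`. -/
def MultiIndex.weight {N d : ℕ} (i : MultiIndex N d) : ℕ := ∑ j, (i j : ℕ)

/-- Vectors of `(ℂ^d)^{⊗N}`, in coordinates with respect to the standard basis. -/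
abbrev QuditVector (N d : ℕ) : Type := MultiIndex N d → ℂ

/-- Operators on `(ℂ^d)^{⊗N}`, as matrices with respect to the standard basis. -/
abbrev QuditOperator (N d : ℕ) : Type := Matrix (MultiIndex N d) (MultiIndex N d) ℂ

/-- The standard basis vector `|i⟩`. -/
def ket {N d : ℕ} (i : MultiIndex N d) : QuditVector N d := Pi.single i 1

/-- The (unnormalized) restricted Dicke vector `|R_{N,d;k}⟩ = ∑_{|i| = k} |i⟩`. -/
def restrictedDicke (N d k : ℕ) : QuditVector N d :=
  ∑ i : MultiIndex N d with i.weight = k, ket i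

/-- The diagonal restricted Dicke operator `∑_{k=0}^{N(d-1)} p_k |R_{N,d;k}⟩⟨R_{N,d;k}|`. -/
def diagonalRestrictedDicke (N d : ℕ) (p : Fin (N * (d - 1) + 1) → ℝ) : QuditOperator N d :=
  ∑ k, (p k : ℂ) •
    Matrix.vecMulVec (restrictedDicke N d (k : ℕ)) (star (restrictedDicke N d (k : ℕ)))

/-- The tensor product `A_1 ⊗ … ⊗ A_N` of operators on `ℂ^d`: its matrix entry
`⟨i| A_1 ⊗ … ⊗ A_N |i'⟩` is the product of the entries `⟨i_j| A_j |i'_j⟩`. -/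
def tensorOperator {N d : ℕ} (A : Fin N → Matrix (Fin d) (Fin d) ℂ) : QuditOperator N d :=
  Matrix.of fun i i' => ∏ j, A j (i j) (i' j)

/-- Full separability of an operator on `(ℂ^d)^{⊗N}`: it is a finite combination, with positive
coefficients, of tensor products of (unnormalized) states, i.e. of positive semidefinite operators
on `ℂ^d`. -/
def FullySeparable {N d : ℕ} (ρ : QuditOperator N d) : Prop :=
  ∃ (m : ℕ) (c : Fin m → ℝ) (A : Fin m → Fin N → Matrix (Fin d) (Fin d) ℂ),
    (∀ a, 0 < c a) ∧ (∀ a j, (A a j).PosSemidef) ∧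
      ρ = ∑ a, (c a : ℂ) • tensorOperator (A a)

/-- `(p_k)_{k=0}^n` is a solution of the generalized moment problem on `[0,∞)`: there are a positive
measure `σ` supported in `[0,∞)`, with finite moments up to order `n`, and a number `M ≥ 0` with
`p_k = ∫ t^k dσ(t)` for `k < n` and `p_n = ∫ t^n dσ(t) + M`. -/
def SolvesGeneralizedMomentProblem {n : ℕ} (p : Fin (n + 1) → ℝ) : Prop :=
  ∃ (σ : MeasureTheory.Measure ℝ) (M : ℝ), σ (Set.Iio 0) = 0 ∧ 0 ≤ M ∧
    (∀ k : Fin (n + 1), MeasureTheory.IntegrableOn (fun t : ℝ => t ^ (k : ℕ)) (Set.Ici 0) σ) ∧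
    ∀ k : Fin (n + 1),
      p k = (∫ t in Set.Ici (0 : ℝ), t ^ (k : ℕ) ∂σ) + if (k : ℕ) = n then M else 0

end

noncomputable section

theorem restrictedDicke_apply {N d : ℕ} (k : ℕ) (i : MultiIndex N d) :
    restrictedDicke N d k i = if i.weight = k then 1 else 0 := by
  simp [restrictedDicke, ket, Finset.sum_apply, Pi.single_apply]

theorem MultiIndex.weight_le {N d : ℕ} (i : MultiIndex N d) : i.weight ≤ N * (d - 1) := by
  have h := Finset.sum_le_card_nsmul Finset.univ (fun j => (i j : ℕ)) (d - 1)
    (fun j _ => Nat.le_sub_one_of_lt (i j).2)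
  simpa [MultiIndex.weight] using h

theorem diagonalRestrictedDicke_apply {N d : ℕ} (p : Fin (N * (d - 1) + 1) → ℝ)
    (i i' : MultiIndex N d) :
    diagonalRestrictedDicke N d p i i' =
      if i.weight = i'.weight then (p ⟨i.weight, Nat.lt_succ_of_le i.weight_le⟩ : ℂ) else 0 := by
  simp only [diagonalRestrictedDicke, Matrix.sum_apply, Matrix.smul_apply, Matrix.vecMulVec_apply,
    Pi.star_apply, restrictedDicke_apply, smul_eq_mul]
  rw [Finset.sum_eq_single ⟨i.weight, Nat.lt_succ_of_le i.weight_le⟩]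
  · by_cases h : i.weight = i'.weight
    · simp [h]
    · simp [h, Ne.symm h]
  · intro k _ hk
    have : i.weight ≠ k := fun h => hk (Fin.ext h.symm)
    simp [this]
  · simp

theorem exists_weight_eq {N d : ℕ} (hd : 0 < d) {k : ℕ} (hk : k ≤ N * (d - 1)) :
    ∃ i : MultiIndex N d, i.weight = k := by
  induction N generalizing k with
  | zero => exact ⟨Fin.elim0, by simp [MultiIndex.weight]; omega⟩
  | succ N ih =>
    have hk' : k ≤ N * (d - 1) + (d - 1) := by rwa [Nat.succ_mul] at hk
    obtain ⟨i, hi⟩ := ih (k := k - min k (d - 1)) (by omega)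
    refine ⟨Fin.cons ⟨min k (d - 1), by omega⟩ i, ?_⟩
    simp only [MultiIndex.weight, Fin.sum_univ_succ, Fin.cons_zero, Fin.cons_succ] at hi ⊢
    omega

@[to_additive]
theorem prod_apply_update_update {ι κ R : Type*} [Fintype ι] [DecidableEq ι] [CommMonoid R]
    (f : ι → κ → R) (i : ι → κ) {l j : ι} (hlj : l ≠ j) (a b : κ) :
    ∏ x, f x (Function.update (Function.update i l a) j b x) =
      f l a * f j b * ∏ x ∈ (Finset.univ.erase l).erase j, f x (i x) := by
  rw [← Finset.mul_prod_erase Finset.univ _ (Finset.mem_univ l),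
    ← Finset.mul_prod_erase (Finset.univ.erase l) _
      (Finset.mem_erase.mpr ⟨hlj.symm, Finset.mem_univ j⟩), ← mul_assoc]
  congr 1
  · simp [hlj]
  · refine Finset.prod_congr rfl fun x hx => ?_
    simp only [Finset.mem_erase] at hx
    simp [hx.1, hx.2.1]

/-- The entries of a product vector depending only on the weight satisfy exchange relations. -/
theorem exchange_of_weight_invariant {N d : ℕ} {v : Fin N → Fin d → ℂ}
    (hv : ∀ i i' : MultiIndex N d, i.weight = i'.weight → ∏ j, v j (i j) = ∏ j, v j (i' j))
    {i : MultiIndex N d} (hi : ∏ j, v j (i j) ≠ 0) {l j : Fin N} (hlj : l ≠ j)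
    {a a' b b' : Fin d} (hab : (a : ℕ) + b = a' + b') :
    v l a * v j b = v l a' * v j b' := by
  have key := hv (Function.update (Function.update i l a) j b)
    (Function.update (Function.update i l a') j b') (by
      simp only [MultiIndex.weight]
      rw [sum_apply_update_update (fun _ (x : Fin d) => (x : ℕ)) i hlj,
        sum_apply_update_update (fun _ (x : Fin d) => (x : ℕ)) i hlj, hab])
  rw [prod_apply_update_update v i hlj, prod_apply_update_update v i hlj] at key
  refine mul_right_cancel₀ ?_ key
  rw [Finset.prod_ne_zero_iff] at hi ⊢
  exact fun x _ => hi x (Finset.mem_univ x)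

/-- If two sites satisfy the exchange relations and the first one vanishes at `0`, then both
vanish below the top level. -/
theorem eq_zero_of_exchange {e : ℕ} {x y : Fin (e + 2) → ℂ} (hx : ∃ a, x a ≠ 0)
    (hy : ∃ a, y a ≠ 0)
    (h : ∀ a a' b b' : Fin (e + 2), (a : ℕ) + b = a' + b' → x a * y b = x a' * y b')
    (h0 : x 0 = 0) : ∀ a : Fin (e + 2), a ≠ Fin.last (e + 1) → x a = 0 ∧ y a = 0 := by
  have hy0 : ∀ b : Fin (e + 2), b ≠ Fin.last (e + 1) → y b = 0 := by
    by_contra! hc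
    obtain ⟨b, hb, hyb⟩ := hc
    obtain ⟨a, ha⟩ := hx
    refine ha ?_
    have hb' : (b : ℕ) < e + 1 := Fin.val_lt_last hb
    have : ∀ m (hm : m < e + 2), x ⟨m, hm⟩ = 0 := by
      intro m
      induction m with
      | zero => exact fun _ => h0
      | succ m ih =>
        intro hm
        have := h ⟨m + 1, hm⟩ ⟨m, by omega⟩ b ⟨b + 1, by omega⟩ (by simp; omega)
        rw [ih (by omega), zero_mul] at this
        exact (mul_eq_zero.mp this).resolve_right hyb
    exact this a a.2
  have hlast : y (Fin.last (e + 1)) ≠ 0 := by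
    obtain ⟨b, hb⟩ := hy
    by_cases hbl : b = Fin.last (e + 1)
    · rwa [← hbl]
    · exact absurd (hy0 b hbl) hb
  intro a ha
  have ha' : (a : ℕ) < e + 1 := Fin.val_lt_last ha
  refine ⟨?_, hy0 a ha⟩
  have := h a ⟨a + 1, by omega⟩ (Fin.last (e + 1)) ⟨e, by omega⟩ (by simp; omega)
  rw [hy0 ⟨e, by omega⟩ (by simp [Fin.ext_iff]), mul_zero] at this
  exact (mul_eq_zero.mp this).resolve_right hlast

/-- A product vector all of whose entries depend only on the weight is, up to a scalar,
`∑ t ^ |i| |i⟩`, or else it is a multiple of the last basis vector. -/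
theorem geometric_or_top_of_weight_invariant {N e : ℕ} (hN : 2 ≤ N) {v : Fin N → Fin (e + 2) → ℂ}
    (hv : ∀ i i' : MultiIndex N (e + 2), i.weight = i'.weight →
      ∏ j, v j (i j) = ∏ j, v j (i' j)) :
    (∃ c t : ℂ, ∀ i : MultiIndex N (e + 2), ∏ j, v j (i j) = c * t ^ i.weight) ∨
      ∃ c : ℂ, ∀ i : MultiIndex N (e + 2),
        ∏ j, v j (i j) = if i.weight = N * (e + 1) then c else 0 := by
  by_cases hz : ∀ i : MultiIndex N (e + 2), ∏ j, v j (i j) = 0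
  · exact Or.inl ⟨0, 0, fun i => by simp [hz i]⟩
  push Not at hz
  obtain ⟨i₀, hi₀⟩ := hz
  have hne : ∀ j, ∃ a, v j a ≠ 0 := fun j =>
    ⟨i₀ j, Finset.prod_ne_zero_iff.mp hi₀ j (Finset.mem_univ j)⟩
  have hex : ∀ {l j : Fin N}, l ≠ j → ∀ a a' b b' : Fin (e + 2), (a : ℕ) + b = a' + b' →
      v l a * v j b = v l a' * v j b' := fun hlj a a' b b' hab =>
    exchange_of_weight_invariant hv hi₀ hlj hab
  have : Nontrivial (Fin N) := Fin.nontrivial_iff_two_le.mpr hN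
  by_cases h0 : ∀ j, v j 0 ≠ 0
  · left
    have hratio : ∀ l j, v l 1 / v l 0 = v j 1 / v j 0 := by
      intro l j
      by_cases hlj : l = j
      · rw [hlj]
      rw [div_eq_div_iff (h0 l) (h0 j), hex hlj 1 0 0 1 (by simp), mul_comm]
    let l₀ : Fin N := ⟨0, by omega⟩
    have hpow : ∀ j m (hm : m < e + 2),
        v j ⟨m, hm⟩ = v j 0 * (v l₀ 1 / v l₀ 0) ^ m := by
      intro j m
      induction m with
      | zero => intro hm; simp
      | succ m ih =>
        intro hm
        obtain ⟨l, hl⟩ := exists_ne j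
        have := hex hl.symm ⟨m + 1, hm⟩ ⟨m, by omega⟩ 0 1 (by simp)
        rw [pow_succ, ← mul_assoc, ← ih (by omega), hratio l₀ l, mul_div_assoc', ← this,
          mul_div_cancel_right₀ _ (h0 l)]
    refine ⟨∏ j, v j 0, v l₀ 1 / v l₀ 0, fun i => ?_⟩
    rw [MultiIndex.weight, ← Finset.prod_pow_eq_pow_sum, ← Finset.prod_mul_distrib]
    exact Finset.prod_congr rfl fun j _ => hpow j (i j) (i j).2
  · right
    push Not at h0
    obtain ⟨l, hl⟩ := h0
    have hvan : ∀ j, ∀ a, a ≠ Fin.last (e + 1) → v j a = 0 := by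
      intro j a ha
      by_cases hlj : l = j
      · obtain ⟨j', hj'⟩ := exists_ne l
        exact hlj ▸ (eq_zero_of_exchange (hne l) (hne j') (hex hj'.symm) hl a ha).1
      · exact (eq_zero_of_exchange (hne l) (hne j) (hex hlj) hl a ha).2
    refine ⟨∏ j, v j (Fin.last (e + 1)), fun i => ?_⟩
    by_cases hi : ∀ j, i j = Fin.last (e + 1)
    · simp [hi, MultiIndex.weight]
    · push Not at hi
      obtain ⟨j, hj⟩ := hi
      have hlt : i.weight < N * (e + 1) := by
        have := Finset.sum_lt_sum (s := Finset.univ) (f := fun j => (i j : ℕ))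
          (g := fun _ => e + 1) (fun j _ => Nat.le_of_lt_succ (i j).2)
          ⟨j, Finset.mem_univ j, Fin.val_lt_last hj⟩
        simpa [MultiIndex.weight] using this
      rw [if_neg hlt.ne]
      exact Finset.prod_eq_zero (Finset.mem_univ j) (hvan j _ hj)

theorem exists_normSq_eq_of_weight_invariant {N d : ℕ} (hN : 2 ≤ N) (hd : 2 ≤ d)
    {v : Fin N → Fin d → ℂ}
    (hv : ∀ i i' : MultiIndex N d, i.weight = i'.weight →
      ∏ j, v j (i j) = ∏ j, v j (i' j)) :
    ∃ C T M : ℝ, 0 ≤ C ∧ 0 ≤ T ∧ 0 ≤ M ∧ ∀ i : MultiIndex N d,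
      Complex.normSq (∏ j, v j (i j)) =
        C * T ^ i.weight + if i.weight = N * (d - 1) then M else 0 := by
  obtain ⟨e, rfl⟩ := Nat.exists_eq_add_of_le' hd
  rcases geometric_or_top_of_weight_invariant hN hv with ⟨c, t, h⟩ | ⟨c, h⟩
  · exact ⟨Complex.normSq c, Complex.normSq t, 0, Complex.normSq_nonneg _,
      Complex.normSq_nonneg _, le_rfl, fun i => by simp [h i]⟩
  · refine ⟨0, 0, Complex.normSq c, le_rfl, le_rfl, Complex.normSq_nonneg _, fun i => ?_⟩
    rw [h i, show e + 2 - 1 = e + 1 from rfl]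
    split_ifs <;> simp

/-- A fully separable operator is a sum of projections onto product vectors. -/
theorem FullySeparable.exists_product_vectors {N d : ℕ} {ρ : QuditOperator N d}
    (h : FullySeparable ρ) :
    ∃ (ι : Type) (_ : Fintype ι) (c : ι → ℝ) (v : ι → Fin N → Fin d → ℂ), (∀ s, 0 < c s) ∧
      ∀ i i' : MultiIndex N d,
        ρ i i' = ∑ s, (c s : ℂ) * ((∏ j, v s j (i j)) * star (∏ j, v s j (i' j))) := by
  obtain ⟨m, c, A, hc, hA, rfl⟩ := h
  choose r w hw using fun a j => Matrix.posSemidef_iff_eq_sum_vecMulVec.mp (hA a j)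
  refine ⟨Σ a, ∀ j, Fin (r a j), inferInstance, fun s => c s.1, fun s j => w s.1 j (s.2 j),
    fun s => hc _, fun i i' => ?_⟩
  rw [Fintype.sum_sigma, Matrix.sum_apply]
  refine Finset.sum_congr rfl fun a _ => ?_
  simp only [Matrix.smul_apply, tensorOperator, Matrix.of_apply, smul_eq_mul]
  rw [← Finset.mul_sum]
  congr 1
  simp_rw [star_prod, ← Finset.prod_mul_distrib]
  rw [← Fintype.prod_sum fun j (x : Fin (r a j)) => w a j x (i j) * star (w a j x (i' j))]
  refine Finset.prod_congr rfl fun j _ => ?_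
  conv_lhs => rw [hw a j]
  simp [Matrix.sum_apply, Matrix.vecMulVec_apply]

/-- The product vectors in a separable decomposition of a diagonal restricted Dicke operator
have entries depending only on the weight. -/
theorem weight_invariant_of_diagonalRestrictedDicke {N d : ℕ} {p : Fin (N * (d - 1) + 1) → ℝ}
    {ι : Type} [Fintype ι] {c : ι → ℝ} {V : ι → MultiIndex N d → ℂ} (hc : ∀ s, 0 < c s)
    (h : ∀ i i' : MultiIndex N d,
      diagonalRestrictedDicke N d p i i' = ∑ s, (c s : ℂ) * (V s i * star (V s i')))
    {i i' : MultiIndex N d} (hi : i.weight = i'.weight) (s : ι) : V s i = V s i' := by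
  have key : ∑ s, c s * Complex.normSq (V s i - V s i') = 0 := by
    have e : ((∑ s, c s * Complex.normSq (V s i - V s i') : ℝ) : ℂ) =
        diagonalRestrictedDicke N d p i i - diagonalRestrictedDicke N d p i i'
          - diagonalRestrictedDicke N d p i' i + diagonalRestrictedDicke N d p i' i' := by
      rw [h, h, h, h, ← Finset.sum_sub_distrib, ← Finset.sum_sub_distrib,
        ← Finset.sum_add_distrib, Complex.ofReal_sum]
      refine Finset.sum_congr rfl fun s _ => ?_
      rw [Complex.ofReal_mul, ← Complex.mul_conj, map_sub]
      simp only [← starRingEnd_apply]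
      ring
    rw [← Complex.ofReal_eq_zero, e]
    simp [diagonalRestrictedDicke_apply, hi]
  rw [Finset.sum_eq_zero_iff_of_nonneg
    fun s _ => mul_nonneg (hc s).le (Complex.normSq_nonneg _)] at key
  have := (mul_eq_zero.mp (key s (Finset.mem_univ s))).resolve_left (hc s).ne'
  exact sub_eq_zero.mp (Complex.normSq_eq_zero.mp this)

open MeasureTheory in
theorem solvesGeneralizedMomentProblem_of_sum {n : ℕ} {p : Fin (n + 1) → ℝ} {ι : Type} [Fintype ι]
    {C T M : ι → ℝ} (hC : ∀ s, 0 ≤ C s) (hT : ∀ s, 0 ≤ T s) (hM : ∀ s, 0 ≤ M s)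
    (h : ∀ k : Fin (n + 1),
      p k = ∑ s, (C s * T s ^ (k : ℕ) + if (k : ℕ) = n then M s else 0)) :
    SolvesGeneralizedMomentProblem p := by
  set σ : Measure ℝ := ∑ s, ENNReal.ofReal (C s) • Measure.dirac (T s) with hσ
  have h0 : σ (Set.Iio 0) = 0 := by
    simp only [hσ, Measure.coe_finsetSum, Finset.sum_apply, Measure.smul_apply, smul_eq_mul]
    refine Finset.sum_eq_zero fun s _ => ?_
    rw [Measure.dirac_apply' _ measurableSet_Iio]
    simp [hT s]
  have hres : σ.restrict (Set.Ici 0) = σ := by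
    refine Measure.restrict_eq_self_of_ae_mem ?_
    rw [ae_iff]
    convert h0 using 2
    ext x
    simp
  have hint : ∀ (s : ι) (k : ℕ),
      Integrable (fun t : ℝ => t ^ k) (ENNReal.ofReal (C s) • Measure.dirac (T s)) := fun s k =>
    (integrable_dirac (by simp)).smul_measure ENNReal.ofReal_ne_top
  refine ⟨σ, ∑ s, M s, h0, Finset.sum_nonneg fun s _ => hM s, fun k => ?_, fun k => ?_⟩
  · rw [IntegrableOn, hres, hσ, integrable_finsetSum_measure]
    exact fun s _ => hint s k
  · rw [hres, hσ, integral_finsetSum_measure fun s _ => hint s k, h k, Finset.sum_add_distrib]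
    congr 1
    · refine Finset.sum_congr rfl fun s _ => ?_
      rw [integral_smul_measure, integral_dirac, ENNReal.toReal_ofReal (hC s), smul_eq_mul]
    · split_ifs <;> simp

theorem solvesGeneralizedMomentProblem_of_fullySeparable {N d : ℕ} (hN : 2 ≤ N) (hd : 2 ≤ d)
    {p : Fin (N * (d - 1) + 1) → ℝ} (h : FullySeparable (diagonalRestrictedDicke N d p)) :
    SolvesGeneralizedMomentProblem p := by
  obtain ⟨ι, _, c, v, hc, hv⟩ := h.exists_product_vectors
  choose C T M hC hT hM hV using fun s => exists_normSq_eq_of_weight_invariant hN hd (v := v s)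
    fun i i' hi => weight_invariant_of_diagonalRestrictedDicke
      (V := fun s i => ∏ j, v s j (i j)) hc hv hi s
  refine solvesGeneralizedMomentProblem_of_sum (C := fun s => c s * C s) (T := T)
    (M := fun s => c s * M s) (fun s => mul_nonneg (hc s).le (hC s)) hT
    (fun s => mul_nonneg (hc s).le (hM s)) fun k => ?_
  obtain ⟨i, hi⟩ := exists_weight_eq (N := N) (by omega : 0 < d) (Nat.le_of_lt_succ k.2)
  have e := hv i i
  rw [diagonalRestrictedDicke_apply, if_pos rfl] at e
  have hk : (⟨i.weight, Nat.lt_succ_of_le i.weight_le⟩ : Fin (N * (d - 1) + 1)) = k := Fin.ext hi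
  rw [hk] at e
  apply Complex.ofReal_injective
  rw [e, Complex.ofReal_sum]
  refine Finset.sum_congr rfl fun s _ => ?_
  rw [← starRingEnd_apply, Complex.mul_conj, hV s i, hi, ← Complex.ofReal_mul]
  congr 1
  split_ifs <;> ring


/-- In finite dimensions the convex hull of a compact set is compact. -/
theorem IsCompact.isCompact_convexHull {E : Type*} [NormedAddCommGroup E] [NormedSpace ℝ E]
    [FiniteDimensional ℝ E] {s : Set E} (hs : IsCompact s) : IsCompact (convexHull ℝ s) := by
  let F : (m : ℕ) → (Fin m → ℝ) × (Fin m → E) → E := fun m x => ∑ i, x.1 i • x.2 i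
  have hF : ∀ m, Continuous (F m) := fun m => by fun_prop
  have heq : convexHull ℝ s = ⋃ m ∈ Finset.range (Module.finrank ℝ E + 2),
      F m '' (stdSimplex ℝ (Fin m) ×ˢ Set.univ.pi fun _ => s) := by
    ext x
    simp only [Set.mem_iUnion, Finset.mem_range, exists_prop]
    constructor
    · intro hx
      obtain ⟨ι, _, z, w, hz, haff, hw, hw1, rfl⟩ := eq_pos_convex_span_of_mem_convexHull hx
      let e := (Fintype.equivFin ι).symm
      refine ⟨Fintype.card ι, ?_, (w ∘ e, z ∘ e), ⟨⟨fun i => (hw _).le, ?_⟩, ?_⟩, ?_⟩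
      · have h1 := haff.card_le_finrank_succ
        have h2 := Submodule.finrank_le (vectorSpan ℝ (Set.range z))
        omega
      · rw [← hw1]
        exact Equiv.sum_comp e w
      · exact fun i _ => hz ⟨_, rfl⟩
      · exact Equiv.sum_comp e fun i => w i • z i
    · rintro ⟨m, -, ⟨w, z⟩, ⟨hw, hz⟩, rfl⟩
      exact (convex_convexHull ℝ s).sum_mem (fun i _ => hw.1 i) hw.2
        fun i _ => subset_convexHull ℝ s (hz i (Set.mem_univ i))
  rw [heq]
  exact Finset.isCompact_biUnion _ fun m _ =>
    ((isCompact_stdSimplex ℝ (Fin m)).prod (isCompact_univ_pi fun _ => hs)).image (hF m)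

theorem FullySeparable.zero {N d : ℕ} : FullySeparable (0 : QuditOperator N d) :=
  ⟨0, Fin.elim0, Fin.elim0, fun a => a.elim0, fun a => a.elim0, by simp⟩

theorem FullySeparable.add {N d : ℕ} {ρ τ : QuditOperator N d} (hρ : FullySeparable ρ)
    (hτ : FullySeparable τ) : FullySeparable (ρ + τ) := by
  obtain ⟨m, c, A, hc, hA, rfl⟩ := hρ
  obtain ⟨m', c', A', hc', hA', rfl⟩ := hτ
  refine ⟨m + m', Fin.append c c', Fin.append A A', fun a => ?_, fun a => ?_, ?_⟩
  · refine Fin.addCases (fun a => ?_) (fun a => ?_) a <;> simp [hc, hc']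
  · refine Fin.addCases (fun a => ?_) (fun a => ?_) a <;> simp [hA, hA']
  · simp [Fin.sum_univ_add]

theorem FullySeparable.smul {N d : ℕ} {ρ : QuditOperator N d} (hρ : FullySeparable ρ) {r : ℝ}
    (hr : 0 ≤ r) : FullySeparable ((r : ℂ) • ρ) := by
  rcases hr.eq_or_lt with rfl | hr
  · simpa using FullySeparable.zero
  obtain ⟨m, c, A, hc, hA, rfl⟩ := hρ
  exact ⟨m, fun a => r * c a, A, fun a => mul_pos hr (hc a), hA, by
    simp only [Finset.smul_sum, smul_smul, Complex.ofReal_mul]⟩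

theorem FullySeparable.sum {N d : ℕ} {ι : Type*} (s : Finset ι) {ρ : ι → QuditOperator N d}
    (h : ∀ a ∈ s, FullySeparable (ρ a)) : FullySeparable (∑ a ∈ s, ρ a) :=
  Finset.sum_induction ρ FullySeparable (fun _ _ => FullySeparable.add) FullySeparable.zero h

theorem fullySeparable_tensorOperator {N d : ℕ} {A : Fin N → Matrix (Fin d) (Fin d) ℂ}
    (hA : ∀ j, (A j).PosSemidef) : FullySeparable (tensorOperator A) :=
  ⟨1, fun _ => 1, fun _ => A, fun _ => one_pos, fun _ => hA, by simp⟩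

theorem diagonalRestrictedDicke_add {N d : ℕ} (p q : Fin (N * (d - 1) + 1) → ℝ) :
    diagonalRestrictedDicke N d (p + q) =
      diagonalRestrictedDicke N d p + diagonalRestrictedDicke N d q := by
  simp [diagonalRestrictedDicke, add_smul, Finset.sum_add_distrib]

theorem diagonalRestrictedDicke_smul {N d : ℕ} (r : ℝ) (p : Fin (N * (d - 1) + 1) → ℝ) :
    diagonalRestrictedDicke N d (r • p) = (r : ℂ) • diagonalRestrictedDicke N d p := by
  simp only [diagonalRestrictedDicke, Finset.smul_sum, smul_smul, Pi.smul_apply, smul_eq_mul,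
    Complex.ofReal_mul]

/-- The homogeneous moment curve `(a ^ (n - k) * b ^ k)_{k ≤ n}`. -/
def homogeneousMomentCurve (n : ℕ) (a b : ℝ) : Fin (n + 1) → ℝ :=
  fun k => a ^ (n - k) * b ^ (k : ℕ)

theorem sum_pow_mul_star_pow_of_isPrimitiveRoot {n : ℕ} {ω : ℂ} (hω : IsPrimitiveRoot ω (n + 1))
    {k l : ℕ} (hk : k ≤ n) (hl : l ≤ n) :
    ∑ r ∈ Finset.range (n + 1), (ω ^ r) ^ k * star ((ω ^ r) ^ l) =
      if k = l then (n + 1 : ℂ) else 0 := by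
  have hn : ω * star ω = 1 := by
    rw [← starRingEnd_apply, Complex.mul_conj, Complex.normSq_eq_norm_sq,
      hω.norm'_eq_one n.succ_ne_zero]
    simp
  have hterm : ∀ r, (ω ^ r) ^ k * star ((ω ^ r) ^ l) = (ω ^ k * star ω ^ l) ^ r := fun r => by
    simp only [star_pow, mul_pow, ← pow_mul, mul_comm]
  simp_rw [hterm]
  split_ifs with h
  · subst h
    simp only [← mul_pow, hn, one_pow, Finset.sum_const, Finset.card_range, nsmul_one]
    push_cast
    rfl
  · have hne : ω ^ k * star ω ^ l ≠ 1 := by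
      intro h1
      refine h (hω.pow_inj (Nat.lt_succ_of_le hk) (Nat.lt_succ_of_le hl) ?_)
      calc ω ^ k = ω ^ k * (ω * star ω) ^ l := by rw [hn, one_pow, mul_one]
        _ = (ω ^ k * star ω ^ l) * ω ^ l := by ring
        _ = ω ^ l := by rw [h1, one_mul]
    have hone : (ω ^ k * star ω ^ l) ^ (n + 1) = 1 := by
      rw [mul_pow, ← pow_mul, ← pow_mul, mul_comm k, mul_comm l, pow_mul, pow_mul, hω.pow_eq_one,
        ← star_pow, hω.pow_eq_one]
      simp
    have := geom_sum_mul (ω ^ k * star ω ^ l) (n + 1)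
    rw [hone, sub_self] at this
    exact (mul_eq_zero.mp this).resolve_right (sub_ne_zero.mpr hne)

theorem prod_pow_mul_pow_weight {N d : ℕ} (x y : ℂ) (i : MultiIndex N d) :
    ∏ j, x ^ (d - 1 - (i j : ℕ)) * y ^ (i j : ℕ) =
      x ^ (N * (d - 1) - i.weight) * y ^ i.weight := by
  rw [Finset.prod_mul_distrib, Finset.prod_pow_eq_pow_sum, Finset.prod_pow_eq_pow_sum]
  congr 2
  rw [Finset.sum_tsub_distrib _ fun j _ => Nat.le_sub_one_of_lt (i j).2]
  simp [MultiIndex.weight]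

/-- Points of the moment curve give separable operators: average the product vectors
`∑ √a ^ (n - |i|) * (ω ^ r * √b) ^ |i| |i⟩` over the powers of a primitive root of unity `ω`. -/
theorem fullySeparable_homogeneousMomentCurve {N d : ℕ} {a b : ℝ} (ha : 0 ≤ a) (hb : 0 ≤ b) :
    FullySeparable (diagonalRestrictedDicke N d (homogeneousMomentCurve (N * (d - 1)) a b)) := by
  set n := N * (d - 1) with hn
  obtain ⟨ω, hω⟩ : ∃ ω : ℂ, IsPrimitiveRoot ω (n + 1) :=
    ⟨_, Complex.isPrimitiveRoot_exp (n + 1) n.succ_ne_zero⟩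
  let w : ℕ → Fin d → ℂ := fun r m =>
    (√a : ℂ) ^ (d - 1 - (m : ℕ)) * (ω ^ r * (√b : ℂ)) ^ (m : ℕ)
  have key : diagonalRestrictedDicke N d (homogeneousMomentCurve n a b) =
      (((n + 1 : ℝ)⁻¹ : ℝ) : ℂ) • ∑ r ∈ Finset.range (n + 1),
        tensorOperator fun _ : Fin N => Matrix.vecMulVec (w r) (star (w r)) := by
    ext i i'
    have hstar : ∀ x : ℝ, star (x : ℂ) = x := Complex.conj_ofReal
    have hterm : ∀ r, tensorOperator (fun _ : Fin N => Matrix.vecMulVec (w r) (star (w r))) i i' =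
        ((√a : ℂ) ^ (n - i.weight) * (√b : ℂ) ^ i.weight *
          ((√a : ℂ) ^ (n - i'.weight) * (√b : ℂ) ^ i'.weight)) *
          ((ω ^ r) ^ i.weight * star ((ω ^ r) ^ i'.weight)) := by
      intro r
      simp only [tensorOperator, Matrix.of_apply, Matrix.vecMulVec_apply, Pi.star_apply]
      rw [Finset.prod_mul_distrib, ← star_prod, prod_pow_mul_pow_weight, prod_pow_mul_pow_weight]
      simp only [star_mul', mul_pow, star_pow, hstar]
      ring
    rw [Matrix.smul_apply, Matrix.sum_apply, Finset.sum_congr rfl fun r _ => hterm r,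
      ← Finset.mul_sum, sum_pow_mul_star_pow_of_isPrimitiveRoot hω i.weight_le i'.weight_le,
      diagonalRestrictedDicke_apply]
    split_ifs with h
    · have hn0 : (n + 1 : ℂ) ≠ 0 := by exact_mod_cast n.succ_ne_zero
      have ha' : (√a : ℂ) ^ (n - i.weight) * (√a : ℂ) ^ (n - i.weight) =
          (a : ℂ) ^ (n - i.weight) := by
        rw [← mul_pow, ← Complex.ofReal_mul, Real.mul_self_sqrt ha]
      have hb' : (√b : ℂ) ^ i.weight * (√b : ℂ) ^ i.weight = (b : ℂ) ^ i.weight := by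
        rw [← mul_pow, ← Complex.ofReal_mul, Real.mul_self_sqrt hb]
      rw [← h, mul_mul_mul_comm, ha', hb']
      simp only [homogeneousMomentCurve, smul_eq_mul]
      push_cast
      field_simp
    · simp
  rw [key]
  exact (FullySeparable.sum _ fun r _ => fullySeparable_tensorOperator fun _ =>
    Matrix.posSemidef_vecMulVec_self_star _).smul (by positivity)

theorem fullySeparable_of_mem_convexHull {N d : ℕ} {p : Fin (N * (d - 1) + 1) → ℝ}
    (hp : p ∈ convexHull ℝ
      ((fun b => homogeneousMomentCurve (N * (d - 1)) (1 - b) b) '' Set.Icc 0 1)) :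
    FullySeparable (diagonalRestrictedDicke N d p) := by
  refine convexHull_min (t := {p | FullySeparable (diagonalRestrictedDicke N d p)}) ?_ ?_ hp
  · rintro _ ⟨b, hb, rfl⟩
    exact fullySeparable_homogeneousMomentCurve (sub_nonneg.mpr hb.2) hb.1
  · intro x hx y hy r s hr hs _
    simp only [Set.mem_ofPred_eq, diagonalRestrictedDicke_add, diagonalRestrictedDicke_smul]
      at hx hy ⊢
    exact (hx.smul hr).add (hy.smul hs)

open MeasureTheory in
/-- The moments of a positive measure on `[0, ∞)` are a multiple of a convex combination of points
of the moment curve. -/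
theorem exists_smul_mem_convexHull_of_moments {n : ℕ} {μ : Measure ℝ}
    (hμ : ∀ᵐ t ∂μ, 0 ≤ t) (hint : ∀ k : Fin (n + 1), Integrable (fun t : ℝ => t ^ (k : ℕ)) μ) :
    ∃ r : ℝ, 0 ≤ r ∧ ∃ q ∈ convexHull ℝ
      ((fun b => homogeneousMomentCurve n (1 - b) b) '' Set.Icc 0 1),
      (fun k : Fin (n + 1) => ∫ t, t ^ (k : ℕ) ∂μ) = r • q := by
  set K := (fun b => homogeneousMomentCurve n (1 - b) b) '' Set.Icc (0 : ℝ) 1 with hK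
  have hcont : Continuous fun b => homogeneousMomentCurve n (1 - b) b := by
    unfold homogeneousMomentCurve
    fun_prop
  have hKc : IsCompact K := isCompact_Icc.image hcont
  set g : ℝ → ENNReal := fun t => ENNReal.ofReal ((1 + t) ^ n) with hg
  have hgm : Measurable g := by fun_prop
  have hgtop : ∀ᵐ t ∂μ, g t < ⊤ := ae_of_all _ fun t => ENNReal.ofReal_lt_top
  set ν := μ.withDensity g with hν
  have hgi : Integrable (fun t : ℝ => (1 + t) ^ n) μ := by
    simp_rw [add_comm (1 : ℝ), add_pow]
    refine integrable_finsetSum _ fun k hk => ?_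
    simp only [one_pow, mul_one]
    exact (hint ⟨k, Finset.mem_range.mp hk⟩).mul_const _
  have : IsFiniteMeasure ν := isFiniteMeasure_withDensity_ofReal hgi.2
  let φ : ℝ → Fin (n + 1) → ℝ := fun t => homogeneousMomentCurve n (1 - t / (1 + t)) (t / (1 + t))
  have hsm : ∀ᵐ t ∂μ, ∀ k : Fin (n + 1), (g t).toReal • φ t k = t ^ (k : ℕ) := by
    filter_upwards [hμ] with t ht k
    have h1 : 0 < 1 + t := by linarith
    have h2 : 1 - t / (1 + t) = 1 / (1 + t) := by field_simp; ring
    simp only [hg, φ, homogeneousMomentCurve]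
    rw [ENNReal.toReal_ofReal (by positivity), h2, smul_eq_mul, div_pow, div_pow, one_pow,
      ← pow_sub_mul_pow (1 + t) (Nat.le_of_lt_succ k.2)]
    field_simp
  have hφi : Integrable φ ν := by
    refine Integrable.of_eval fun k => ?_
    rw [hν, integrable_withDensity_iff_integrable_smul' hgm hgtop]
    exact (hint k).congr (hsm.mono fun t ht => (ht k).symm)
  have hφ : ∀ k : Fin (n + 1), ∫ t, t ^ (k : ℕ) ∂μ = (∫ t, φ t ∂ν) k := fun k => by
    rw [eval_integral fun k => hφi.eval k, hν,
      integral_withDensity_eq_integral_toReal_smul hgm hgtop]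
    exact integral_congr_ae (hsm.mono fun t ht => (ht k).symm)
  have hφK : ∀ᵐ t ∂ν, φ t ∈ convexHull ℝ K := by
    refine (withDensity_absolutelyContinuous μ g).ae_le (hμ.mono fun t ht => ?_)
    refine subset_convexHull ℝ K ⟨t / (1 + t), ⟨by positivity, ?_⟩, rfl⟩
    rw [div_le_one (by linarith)]
    linarith
  rcases eq_zero_or_neZero ν with h0 | h0
  · refine ⟨0, le_rfl, _, subset_convexHull ℝ K ⟨0, by simp, rfl⟩, ?_⟩
    ext k
    rw [hφ k, h0]
    simp
  · refine ⟨ν.real Set.univ, measureReal_nonneg, ⨍ t, φ t ∂ν,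
      (convex_convexHull ℝ K).average_mem hKc.isCompact_convexHull.isClosed hφK hφi, ?_⟩
    rw [measure_smul_average]
    exact funext hφ

theorem fullySeparable_of_solvesGeneralizedMomentProblem {N d : ℕ}
    {p : Fin (N * (d - 1) + 1) → ℝ} (h : SolvesGeneralizedMomentProblem p) :
    FullySeparable (diagonalRestrictedDicke N d p) := by
  obtain ⟨σ, M, -, hM, hint, hp⟩ := h
  obtain ⟨r, hr, q, hq, hrq⟩ := exists_smul_mem_convexHull_of_moments
    (μ := σ.restrict (Set.Ici 0))
    (MeasureTheory.ae_restrict_mem measurableSet_Ici) hint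
  have hpq : p = r • q + M • homogeneousMomentCurve (N * (d - 1)) 0 1 := by
    rw [← hrq]
    ext k
    have hk : (k : ℕ) = N * (d - 1) ↔ N * (d - 1) - k = 0 := by omega
    simp only [hp k, Pi.add_apply, Pi.smul_apply, homogeneousMomentCurve, one_pow, mul_one,
      zero_pow_eq, hk, smul_eq_mul, mul_ite, mul_zero]
  rw [hpq, diagonalRestrictedDicke_add, diagonalRestrictedDicke_smul, diagonalRestrictedDicke_smul]
  exact ((fullySeparable_of_mem_convexHull hq).smul hr).add
    ((fullySeparable_homogeneousMomentCurve le_rfl zero_le_one).smul hM)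

end

theorem theoremt (N d : ℕ) (hN : 2 ≤ N) (hd : 2 ≤ d)
    (p : Fin (N * (d - 1) + 1) → ℝ) (hp : ∀ k, 0 ≤ p k) :
    FullySeparable (diagonalRestrictedDicke N d p) ↔ SolvesGeneralizedMomentProblem p :=
  ⟨solvesGeneralizedMomentProblem_of_fullySeparable hN hd,
    fullySeparable_of_solvesGeneralizedMomentProblem⟩
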